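/- **Definitions.** Let $F=\bigoplus_{h,\bar h\in\mathbb R}F_{h,\bar h}$ be an $\mathbb R^2$-graded complex vector space such that $F_{h,\bar h}=0$ unless $h-\bar h\in\mathbb Z$ and $h,\bar h\ge 0$, and such that $\bigoplus_{h+\bar h\le H}F_{h,\bar h}$ is finite-dimensional for every $H\in\mathbb R$. Let $L(0),\bar L(0)$ act on $F_{h,\bar h}$ as $h,\bar h$. A *full vertex algebra* structure on $F$ consists of a vector $\mathbf 1\in F_{0,0}$ and a linear map $a\mapsto Y(a,z,\bar z)=\sum_{r,s\in\mathbb R}a(r,s)z^{-r-1}\bar z^{-s-1}$ with $a(r,s)\in\mathrm{End}(F)$, $a(r,s)=0$ unless $r-s\in\mathbb Z$, such that: * $[L(0),Y(a,z,\bar z)]=z\frac{d}{dz}Y(a,z,\bar z)+Y(L(0)a,z,\bar z)$ and $[\bar L(0),Y(a,z,\bar z)]=\bar z\frac{d}{d\bar z}Y(a,z,\bar z)+Y(\bar L(0)a,z,\bar z)$; * $Y(a,z,\bar z)\mathbf 1\in F[[z,\bar z]]$ with constant term $a(-1,-1)\mathbf 1=a$, and $Y(\mathbf 1,z,\bar z)=\mathrm{id}_F$;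 * for homogeneous $a,b,c\in F$ and $u\in F_{h_0,\bar h_0}^*$ (extended by $0$ to $F$) there is a real analytic function $\mu$ on $Y_2(\mathbb C)=\{(\zeta_1,\zeta_2)\in\mathbb C^2: \zeta_1\ne\zeta_2,\ \zeta_1\neq 0,\ \zeta_2\ne0\}$ such that, with absolute convergence on the part of the indicated domain where the arguments of $\mu$ lie in $Y_2(\mathbb C)$, $u(Y(a,\zeta_1,\bar\zeta_1)Y(b,\zeta_2,\bar\zeta_2)c)=\mu(\zeta_1,\zeta_2)$ for $|\zeta_1|>|\zeta_2|$, $u(Y(Y(a,\zeta_0,\bar\zeta_0)b,\zeta_2,\bar\zeta_2)c)=\mu(\zeta_0+\zeta_2,\zeta_2)$ for $|\zeta_2|>|\zeta_0|$, and $u(Y(b,\zeta_2,\bar\zeta_2)Y(a,\zeta_1,\bar\zeta_1)c)=\mu(\zeta_1,\zeta_2)$ for $|\zeta_2|>|\zeta_1|$. Put $Da=a(-2,-1)\mathbf 1$ and $\bar Da=a(-1,-2)\mathbf 1$. A *full vertex operator algebra (full VOA)* is a full vertex algebra with vectors $\nu\in F_{2,0}$, $\bar\nu\in F_{0,2}$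 such that $\bar D\nu=0=D\bar\nu$; $\nu(3,-1)\nu=\frac c2\mathbf 1$ and $\bar\nu(-1,3)\bar\nu=\frac{\bar c}2\mathbf 1$ for some $c,\bar c\in\mathbb C$; $\nu(k,-1)\nu=0=\bar\nu(-1,k)\bar\nu$ for $k=2$ and all integers $k\ge4$; $\nu(0,-1)=D$, $\bar\nu(-1,0)=\bar D$; and $\nu(1,-1)=L(0)$, $\bar\nu(-1,1)=\bar L(0)$. Write $L(n)=\nu(n+1,-1)$ and $\bar L(n)=\bar\nu(-1,n+1)$. A full VOA $F$ is *unitary* if it is equipped with a bilinear form $(\cdot,\cdot)$ that is invariant, i.e. $$(u,Y(a,z,\bar z)v)=\bigl(Y(e^{L(1)z+\bar L(1)\bar z}(-1)^{L(0)-\bar L(0)}z^{-2L(0)}\bar z^{-2\bar L(0)}a,z^{-1},\bar z^{-1})u,v\bigr)\quad(a,u,v\in F),$$ normalized by $(\mathbf 1,\mathbf 1)=1$, and an anti-linear map $\phi:F\to F$ with $\phi^2=\mathrm{id}$, $\phi(\mathbf 1)=\mathbf 1$, $\phi(\nu)=\nu$, $\phi(\bar\nu)=\bar\nu$, $\phi(a(r,s)b)=\phi(a)(r,s)\phi(b)$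 for all $a,b\in F$ and $r,s\in\mathbb R$, such that the sesquilinear form $\langle u,v\rangle=(\phi(u),v)$ is positive definite. An *ideal* of $F$ is a subspace $I\subset F$ with $a(r,s)v\in I$ for all $a\in F$, $v\in I$, $r,s\in\mathbb R$; $F$ is *simple* if its only ideals are $0$ and $F$. **Proposition.** Let $F$ be a unitary full VOA. Then $F$ is simple if and only if $F_{0,0}=\mathbb C\mathbf 1$. -/

import Mathlib

noncomputable section

namespace FullVA

/-- An `ℝ²`-graded complex vector space `F = ⨁ F_{h,h'}` (internal direct sum of the subspaces
`gr (h, h')`) satisfying the conditions FO1, FO2, FO3. -/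
structure GradedSpace (F : Type*) [AddCommGroup F] [Module ℂ F] where
  /-- The homogeneous subspace of weight `(h, h')`. -/
  gr : ℝ × ℝ → Submodule ℂ F
  isInternal : DirectSum.IsInternal gr
  /-- FO1: `F_{h,h'} = 0` unless `h - h' ∈ ℤ`. -/
  spin_int : ∀ p : ℝ × ℝ, (¬ ∃ n : ℤ, p.1 - p.2 = n) → gr p = ⊥
  /-- FO2: `F_{h,h'} = 0` unless `h ≥ 0` and `h' ≥ 0`. -/
  weight_nonneg : ∀ p : ℝ × ℝ, ¬ (0 ≤ p.1 ∧ 0 ≤ p.2) → gr p = ⊥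
  /-- FO3: `⨁_{h + h' ≤ H} F_{h,h'}` is finite-dimensional for every real `H`. -/
  finite_dim : ∀ H : ℝ,
    FiniteDimensional ℂ (⨆ p : ℝ × ℝ, ⨆ _ : p.1 + p.2 ≤ H, gr p : Submodule ℂ F)

namespace GradedSpace

variable {F : Type*} [AddCommGroup F] [Module ℂ F]

theorem bijective_coe (G : GradedSpace F) :
    Function.Bijective (DirectSum.coeLinearMap G.gr) := G.isInternal

/-- The linear map acting on each homogeneous subspace `gr p` as the scalar `w p`. -/
def scalarOp (G : GradedSpace F) (w : ℝ × ℝ → ℝ) : Module.End ℂ F :=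
  DirectSum.toModule ℂ (ℝ × ℝ) F (fun p => (w p : ℂ) • (G.gr p).subtype) ∘ₗ
    (LinearEquiv.ofBijective (DirectSum.coeLinearMap G.gr) G.bijective_coe).symm.toLinearMap

theorem scalarOp_apply (G : GradedSpace F) (w : ℝ × ℝ → ℝ) (p : ℝ × ℝ) (v : F)
    (hv : v ∈ G.gr p) : G.scalarOp w v = (w p : ℂ) • v := by
  have h : (LinearEquiv.ofBijective (DirectSum.coeLinearMap G.gr) G.bijective_coe).symm v
      = DirectSum.lof ℂ (ℝ × ℝ) (fun p => G.gr p) p ⟨v, hv⟩ := by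
    rw [LinearEquiv.symm_apply_eq, LinearEquiv.ofBijective_apply]
    exact (DirectSum.coeLinearMap_lof G.gr p ⟨v, hv⟩).symm
  simp [scalarOp, h]

/-- `L(0)`: multiplication by `h` on `F_{h,h'}`. -/
def L0 (G : GradedSpace F) : Module.End ℂ F := G.scalarOp Prod.fst

/-- The antiholomorphic `L(0)`: multiplication by `h'` on `F_{h,h'}`. -/
def Lbar0 (G : GradedSpace F) : Module.End ℂ F := G.scalarOp Prod.snd

end GradedSpace

/-- The value of the formal monomial `z^x z̄^y`, where `x - y` is an integer, at the complex number
`ζ`: it is `ζ^(x-y) |ζ|^(2y)`. (It is only ever used with a coefficient that vanishes unless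
`x - y` is an integer, and with `ζ ≠ 0`.) -/
def evalMonomial (ζ : ℂ) (x y : ℝ) : ℂ := ζ ^ ⌊x - y⌋ * ((‖ζ‖ ^ (2 * y) : ℝ) : ℂ)

/-- The term with index `((r₁, s₁), (r₂, s₂))` of the formal series
`∑ c (r₁,s₁) (r₂,s₂) z₁^(-r₁-1) z̄₁^(-s₁-1) z₂^(-r₂-1) z̄₂^(-s₂-1)`, evaluated at `(ζ₁, ζ₂)`. -/
def seriesTerm (c : ℝ × ℝ → ℝ × ℝ → ℂ) (ζ₁ ζ₂ : ℂ) (x : (ℝ × ℝ) × (ℝ × ℝ)) : ℂ :=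
  c x.1 x.2 * evalMonomial ζ₁ (-x.1.1 - 1) (-x.1.2 - 1) *
    evalMonomial ζ₂ (-x.2.1 - 1) (-x.2.2 - 1)

/-- The domain `Y₂(ℂ)`. -/
def Y2 : Set (ℂ × ℂ) := {p | p.1 ≠ p.2 ∧ p.1 ≠ 0 ∧ p.2 ≠ 0}

/-- A full vertex algebra structure on `F`. The vertex operator is given by its modes:
`Y(a, z, z̄) = ∑ a(r,s) z^(-r-1) z̄^(-s-1)` with `a(r,s) = mode a r s`. -/
structure FullVertexAlgebra (F : Type*) [AddCommGroup F] [Module ℂ F] extends GradedSpace F where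
  mode : F →ₗ[ℂ] (ℝ → ℝ → Module.End ℂ F)
  /-- Only monomials `z^x z̄^y` with `x - y ∈ ℤ` occur in `Y(a, z, z̄)`. -/
  mode_int : ∀ (a : F) (r s : ℝ), (¬ ∃ n : ℤ, r - s = n) → mode a r s = 0
  /-- `[L(0), Y(a,z,z̄)] = z d/dz Y(a,z,z̄) + Y(L(0)a,z,z̄)`, coefficientwise. -/
  L0_cov : ∀ (a : F) (r s : ℝ),
    toGradedSpace.L0 * mode a r s - mode a r s * toGradedSpace.L0 =
      ((-r - 1 : ℝ) : ℂ) • mode a r s + mode (toGradedSpace.L0 a) r s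
  /-- The same for the antiholomorphic variable. -/
  Lbar0_cov : ∀ (a : F) (r s : ℝ),
    toGradedSpace.Lbar0 * mode a r s - mode a r s * toGradedSpace.Lbar0 =
      ((-s - 1 : ℝ) : ℂ) • mode a r s + mode (toGradedSpace.Lbar0 a) r s
  /-- The vacuum vector. -/
  vac : F
  vac_mem : vac ∈ gr (0, 0)
  /-- FV1: `Y(a,z,z̄)𝟏` has only monomials `z^n z̄^m` with `n, m ∈ ℕ`. -/
  creation : ∀ (a : F) (r s : ℝ),
    (¬ ∃ n m : ℕ, -r - 1 = (n : ℝ) ∧ -s - 1 = (m : ℝ)) → mode a r s vac = 0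
  /-- FV1: the constant term of `Y(a,z,z̄)𝟏` is `a`. -/
  creation_const : ∀ a : F, mode a (-1) (-1) vac = a
  /-- FV2: `Y(𝟏,z,z̄) = id`. -/
  vac_const : mode vac (-1) (-1) = 1
  vac_mode : ∀ r s : ℝ, (r, s) ≠ (-1, -1) → mode vac r s = 0
  /-- FV3, for homogeneous `a, b, c` and a functional `u` in the dual of a homogeneous subspace
  (extended by zero to the other ones): the products and iterates converge absolutely (a family
  of complex numbers is summable iff it is absolutely summable) to a common real analytic function
  on `Y₂(ℂ)`. -/
  locality : ∀ (p₀ p₁ p₂ p₃ : ℝ × ℝ) (u : Module.Dual ℂ F) (a b c : F),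
    (∀ p, p ≠ p₀ → ∀ v ∈ gr p, u v = 0) → a ∈ gr p₁ → b ∈ gr p₂ → c ∈ gr p₃ →
    ∃ μ : ℂ × ℂ → ℂ, AnalyticOnNhd ℝ μ Y2 ∧
      (∀ ζ₁ ζ₂ : ℂ, (ζ₁, ζ₂) ∈ Y2 → ‖ζ₂‖ < ‖ζ₁‖ →
        HasSum (seriesTerm
          (fun x y => u (mode a x.1 x.2 (mode b y.1 y.2 c))) ζ₁ ζ₂) (μ (ζ₁, ζ₂))) ∧
      (∀ ζ₀ ζ₂ : ℂ, (ζ₀ + ζ₂, ζ₂) ∈ Y2 → ‖ζ₀‖ < ‖ζ₂‖ →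
        HasSum (seriesTerm
          (fun x y => u (mode (mode a x.1 x.2 b) y.1 y.2 c)) ζ₀ ζ₂) (μ (ζ₀ + ζ₂, ζ₂))) ∧
      (∀ ζ₁ ζ₂ : ℂ, (ζ₁, ζ₂) ∈ Y2 → ‖ζ₁‖ < ‖ζ₂‖ →
        HasSum (seriesTerm
          (fun y x => u (mode b y.1 y.2 (mode a x.1 x.2 c))) ζ₂ ζ₁) (μ (ζ₁, ζ₂)))

/-- A full vertex operator algebra structure on `F`: a full vertex algebra with conformal vectors
`ν ∈ F_{2,0}` and `ν̄ ∈ F_{0,2}`. Here `D a = a(-2,-1)𝟏` and `D̄ a = a(-1,-2)𝟏` are written out. -/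
structure FullVOA (F : Type*) [AddCommGroup F] [Module ℂ F] extends FullVertexAlgebra F where
  ν : F
  νbar : F
  ν_mem : ν ∈ gr (2, 0)
  νbar_mem : νbar ∈ gr (0, 2)
  Dbar_ν : mode ν (-1) (-2) vac = 0
  D_νbar : mode νbar (-2) (-1) vac = 0
  central_charge : ∃ c : ℂ, mode ν 3 (-1) ν = (c / 2) • vac
  central_charge_bar : ∃ c : ℂ, mode νbar (-1) 3 νbar = (c / 2) • vac
  ν_ν : ∀ k : ℤ, k = 2 ∨ 4 ≤ k → mode ν k (-1) ν = 0
  νbar_νbar : ∀ k : ℤ, k = 2 ∨ 4 ≤ k → mode νbar (-1) k νbar = 0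
  ν_zero : ∀ a : F, mode ν 0 (-1) a = mode a (-2) (-1) vac
  νbar_zero : ∀ a : F, mode νbar (-1) 0 a = mode a (-1) (-2) vac
  ν_one : ∀ p : ℝ × ℝ, ∀ v ∈ gr p, mode ν 1 (-1) v = (p.1 : ℂ) • v
  νbar_one : ∀ p : ℝ × ℝ, ∀ v ∈ gr p, mode νbar (-1) 1 v = (p.2 : ℂ) • v

namespace FullVOA

variable {F : Type*} [AddCommGroup F] [Module ℂ F]

/-- `L(n) = ν(n+1,-1)`. -/
def L (V : FullVOA F) (n : ℤ) : Module.End ℂ F := V.mode V.ν (n + 1) (-1)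

/-- The antiholomorphic `L(n)`, which is `ν̄(-1,n+1)`. -/
def Lbar (V : FullVOA F) (n : ℤ) : Module.End ℂ F := V.mode V.νbar (-1) (n + 1)

/-- Invariance of a bilinear form:
`(u, Y(a,z)v) = (Y(exp(L(1)z + L̄(1)z̄) (-1)^(L(0)-L̄(0)) z^(-2L(0)) z̄^(-2L̄(0)) a, z⁻¹)u, v)`
as formal series. For `a ∈ F_{h,h'}` this is the comparison, for all `r, s`, of the coefficients of
`z^(-r-1) z̄^(-s-1)`, where `exp(L(1)z + L̄(1)z̄) = ∑ z^n z̄^m L(1)^n L̄(1)^m / (n! m!)` as `L(1)` and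
`L̄(1)` commute. Only finitely many terms of the sum are nonzero, since `L(1)` and `L̄(1)` lower
the weights `h` and `h'` by one. -/
def IsInvariant (V : FullVOA F) (B : LinearMap.BilinForm ℂ F) : Prop :=
  ∀ (h h' : ℝ) (a : F), a ∈ V.gr (h, h') → ∀ (r s : ℝ) (u v : F),
    B u (V.mode a r s v) =
      ∑ᶠ k : ℕ × ℕ, ((-1 : ℂ) ^ ⌊h - h'⌋ / ((k.1.factorial : ℂ) * (k.2.factorial : ℂ))) *
        B (V.mode ((V.L 1 ^ k.1) ((V.Lbar 1 ^ k.2) a))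
          (2 * h - k.1 - r - 2) (2 * h' - k.2 - s - 2) u) v

/-- An anti-linear involution: an anti-linear automorphism whose square is the identity. -/
structure IsAntilinearInvolution (V : FullVOA F) (φ : F →ₛₗ[starRingEnd ℂ] F) : Prop where
  map_vac : φ V.vac = V.vac
  map_ν : φ V.ν = V.ν
  map_νbar : φ V.νbar = V.νbar
  map_mode : ∀ (a b : F) (r s : ℝ), φ (V.mode a r s b) = V.mode (φ a) r s (φ b)
  involutive : ∀ a : F, φ (φ a) = a

/-- `(F, φ)` is unitary with respect to the invariant bilinear form `B`: the sesquilinear form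
`⟨u, v⟩ = B (φ u) v` is positive definite. As usual `B` is normalized by `B 𝟏 𝟏 = 1`. -/
structure IsUnitary (V : FullVOA F) (φ : F →ₛₗ[starRingEnd ℂ] F)
    (B : LinearMap.BilinForm ℂ F) : Prop where
  invariant : V.IsInvariant B
  involution : V.IsAntilinearInvolution φ
  pos_def : ∀ u : F, u ≠ 0 → 0 < (B (φ u) u).re ∧ (B (φ u) u).im = 0
  normalized : B V.vac V.vac = 1

/-- An ideal: a subspace stable under all modes `a(r,s)`. -/
def IsIdeal (V : FullVOA F) (I : Submodule ℂ F) : Prop :=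
  ∀ (a v : F), v ∈ I → ∀ r s : ℝ, V.mode a r s v ∈ I

/-- Simplicity: the only ideals are `0` and `F`. -/
def IsSimple (V : FullVOA F) : Prop :=
  ∀ I : Submodule ℂ F, V.IsIdeal I → I = ⊥ ∨ I = ⊤

end FullVOA

end FullVA

end

/-! Suppose `F` is simple and `v` has weight `(0,0)`. Invariance makes `L(1)` adjoint to `L(-1) =
D`, so `⟨Dv, Dv⟩` is a pairing with `L(1)D φ(v)`, which vanishes because `L(0)φ(v) = 0`. Positivity
gives `Dv = 0`, and likewise `D̄v = 0`. Hence `Y(v,z,z̄)` is the constant `v(-1,-1)`, which by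
locality commutes with all modes. Its eigenspaces are therefore ideals. One of them is nonzero since
`F_{0,0}` is finite-dimensional, so simplicity makes `v(-1,-1)` a scalar `c`, and `v = v(-1,-1)𝟏 =
c𝟏`. The three steps are `mode_vac_eq_zero`, `mode_eq_zero_of_derivative_eq_zero` and
`commute_mode_of_forall_eq_zero`; no commutator formula is used, each locality argument comparing
two expansions of `μ` on the slice `ζ₂ = 1`.

Conversely, a nonzero ideal contains a nonzero homogeneous `x` killed by `L(1)` and `L̄(1)`
(`exists_quasiprimary`). The mode of `φ(x)` sending `x` to weight `(0,0)` yields a multiple of `𝟏`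
with coefficient `±⟨x,x⟩ ≠ 0`, so the ideal contains `𝟏`, which generates `F`. -/

namespace FullVA

/-! ### Linear algebra of the bigrading -/

namespace GradedSpace

variable {F : Type*} [AddCommGroup F] [Module ℂ F] (G : GradedSpace F)

/-- The projection onto the homogeneous subspace of weight `p`, as an endomorphism. -/
noncomputable def proj (p : ℝ × ℝ) : Module.End ℂ F :=
  (G.gr p).subtype ∘ₗ DirectSum.component ℂ (ℝ × ℝ) (fun p => G.gr p) p ∘ₗ
    (LinearEquiv.ofBijective (DirectSum.coeLinearMap G.gr) G.bijective_coe).symm.toLinearMap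

theorem proj_mem (p : ℝ × ℝ) (v : F) : G.proj p v ∈ G.gr p := by
  simp [proj]

theorem ofBijective_symm_apply_of_mem {p : ℝ × ℝ} {v : F} (hv : v ∈ G.gr p) :
    (LinearEquiv.ofBijective (DirectSum.coeLinearMap G.gr) G.bijective_coe).symm v
      = DirectSum.lof ℂ (ℝ × ℝ) (fun p => G.gr p) p ⟨v, hv⟩ := by
  rw [LinearEquiv.symm_apply_eq, LinearEquiv.ofBijective_apply]
  exact (DirectSum.coeLinearMap_lof G.gr p ⟨v, hv⟩).symm

theorem proj_of_mem {p : ℝ × ℝ} {v : F} (hv : v ∈ G.gr p) : G.proj p v = v := by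
  simp [proj, G.ofBijective_symm_apply_of_mem hv, DirectSum.component.lof_self]

theorem proj_of_mem_of_ne {p q : ℝ × ℝ} {v : F} (hv : v ∈ G.gr q) (h : q ≠ p) :
    G.proj p v = 0 := by
  simp [proj, G.ofBijective_symm_apply_of_mem hv, DirectSum.component.of, h]

theorem iSup_gr : ⨆ p, G.gr p = ⊤ := G.isInternal.submodule_iSup_eq_top

/-- Linear maps that agree on homogeneous vectors are equal. -/
theorem hom_ext {M : Type*} [AddCommGroup M] [Module ℂ M] {f g : F →ₗ[ℂ] M}
    (h : ∀ p, ∀ v ∈ G.gr p, f v = g v) : f = g := by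
  have : (⊤ : Submodule ℂ F) ≤ LinearMap.eqLocus f g := by
    rw [← G.iSup_gr]
    exact iSup_le fun p v hv => h p v hv
  exact LinearMap.ext fun v => this trivial

theorem proj_scalarOp (w : ℝ × ℝ → ℝ) (p : ℝ × ℝ) (v : F) :
    G.proj p (G.scalarOp w v) = (w p : ℂ) • G.proj p v := by
  have : G.proj p ∘ₗ G.scalarOp w = (w p : ℂ) • G.proj p := by
    refine G.hom_ext fun q v hv => ?_
    simp only [LinearMap.comp_apply, LinearMap.smul_apply, G.scalarOp_apply w q v hv, map_smul]
    by_cases h : q = p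
    · rw [h]
    · simp [G.proj_of_mem_of_ne hv h]
  exact LinearMap.congr_fun this v

theorem eq_zero_of_forall_proj {v : F} (h : ∀ p, G.proj p v = 0) : v = 0 := by
  set e := LinearEquiv.ofBijective (DirectSum.coeLinearMap G.gr) G.bijective_coe with he
  have : e.symm v = 0 := by
    refine DFinsupp.ext fun p => Subtype.ext ?_
    exact (Submodule.coe_eq_zero (p := G.gr p)).1 (h p) |>.symm ▸ rfl
  simpa using this

theorem mem_gr_of_forall_proj {p : ℝ × ℝ} {v : F} (h : ∀ q, q ≠ p → G.proj q v = 0) :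
    v ∈ G.gr p := by
  have : v - G.proj p v = 0 := by
    refine G.eq_zero_of_forall_proj fun q => ?_
    by_cases hq : q = p
    · subst hq
      rw [map_sub, G.proj_of_mem (G.proj_mem q v), sub_self]
    · rw [map_sub, h q hq, G.proj_of_mem_of_ne (G.proj_mem p v) (Ne.symm hq), sub_self]
  rw [sub_eq_zero.1 this]
  exact G.proj_mem p v

theorem finite_support_proj (v : F) : {p | G.proj p v ≠ 0}.Finite := by
  have hv : v ∈ ⨆ p, G.gr p := G.iSup_gr ▸ Submodule.mem_top
  induction hv using Submodule.iSup_induction' with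
  | mem p x hx =>
    refine (Set.finite_singleton p).subset fun q hq => ?_
    by_contra h
    exact hq (G.proj_of_mem_of_ne hx (Ne.symm h))
  | zero => simp
  | add x y _ _ hx hy =>
    refine (hx.union hy).subset fun q hq => ?_
    by_contra h
    simp only [Set.mem_union, Set.mem_ofPred_eq, not_or, not_not] at h
    exact hq (by rw [map_add, h.1, h.2, add_zero])

/-- The pair of eigenvalues determines the weight, since a nonzero component in weight `q` forces `q
= p`. Weights can thus be read off the covariance axioms. -/
theorem mem_gr_iff {p : ℝ × ℝ} {v : F} :
    v ∈ G.gr p ↔ G.L0 v = (p.1 : ℂ) • v ∧ G.Lbar0 v = (p.2 : ℂ) • v := by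
  refine ⟨fun h => ⟨G.scalarOp_apply _ p v h, G.scalarOp_apply _ p v h⟩, fun ⟨h1, h2⟩ => ?_⟩
  refine G.mem_gr_of_forall_proj fun q hq => ?_
  have e1 := congrArg (G.proj q) h1
  have e2 := congrArg (G.proj q) h2
  rw [L0, proj_scalarOp, map_smul, ← sub_eq_zero, ← sub_smul, smul_eq_zero, sub_eq_zero] at e1
  rw [Lbar0, proj_scalarOp, map_smul, ← sub_eq_zero, ← sub_smul, smul_eq_zero, sub_eq_zero] at e2
  by_contra hne
  exact hq (Prod.ext (by exact_mod_cast e1.resolve_right hne)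
    (by exact_mod_cast e2.resolve_right hne))

/-- A nonzero subspace stable under `L(0)` and `L̄(0)` contains a nonzero homogeneous vector. -/
theorem exists_homogeneous_mem {I : Submodule ℂ F} (h0 : ∀ v ∈ I, G.L0 v ∈ I)
    (h1 : ∀ v ∈ I, G.Lbar0 v ∈ I) {v : F} (hv : v ∈ I) (hne : v ≠ 0) :
    ∃ p, ∃ x ∈ G.gr p, x ∈ I ∧ x ≠ 0 := by
  obtain ⟨n, hn⟩ : ∃ n, {p | G.proj p v ≠ 0}.ncard = n := ⟨_, rfl⟩
  induction n using Nat.strong_induction_on generalizing v with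
  | _ n ih =>
    obtain ⟨p, hp⟩ : ∃ p, G.proj p v ≠ 0 := by
      by_contra! h
      exact hne (G.eq_zero_of_forall_proj h)
    by_cases hq : ∃ q, q ≠ p ∧ G.proj q v ≠ 0
    · obtain ⟨q, hqp, hq⟩ := hq
      -- One of `L(0)`, `L̄(0)` separates `p` from `q`; subtracting its eigenvalue at `p` kills the
      -- `p`-component, keeps the `q`-component and creates no new one.
      obtain ⟨w, hw, hwI⟩ : ∃ w : ℝ × ℝ → ℝ, w q ≠ w p ∧ ∀ v ∈ I, G.scalarOp w v ∈ I := by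
        by_cases h : q.1 = p.1
        · exact ⟨Prod.snd, fun h' => hqp (Prod.ext h h'), h1⟩
        · exact ⟨Prod.fst, h, h0⟩
      have key : ∀ r, G.proj r (G.scalarOp w v - (w p : ℂ) • v)
          = ((w r : ℂ) - w p) • G.proj r v := fun r => by
        rw [map_sub, proj_scalarOp, map_smul, sub_smul]
      refine ih _ ?_ (v := G.scalarOp w v - (w p : ℂ) • v)
        (I.sub_mem (hwI v hv) (I.smul_mem _ hv)) ?_ rfl
      · rw [← hn]
        refine Set.ncard_lt_ncard ⟨fun r hr hr' => hr ?_, fun h => ?_⟩ (G.finite_support_proj v)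
        · rw [key, hr', smul_zero]
        · exact h hp (by rw [key, sub_self, zero_smul])
      · intro h
        have := key q
        rw [h, map_zero, eq_comm, smul_eq_zero, sub_eq_zero] at this
        exact this.elim (fun h => hw (by exact_mod_cast h)) hq
    · push Not at hq
      exact ⟨p, v, G.mem_gr_of_forall_proj hq, hv, hne⟩

/-- Functionals on a homogeneous subspace, extended by zero, separate its vectors. -/
theorem eq_of_forall_dual {p : ℝ × ℝ} {x y : F} (hx : x ∈ G.gr p) (hy : y ∈ G.gr p)
    (h : ∀ u : Module.Dual ℂ F, (∀ q, q ≠ p → ∀ v ∈ G.gr q, u v = 0) → u x = u y) : x = y := by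
  rw [← sub_eq_zero, ← Module.forall_dual_apply_eq_zero_iff ℂ]
  intro f
  have := h (f ∘ₗ G.proj p) fun q hq v hv => by simp [G.proj_of_mem_of_ne hv hq]
  simpa [G.proj_of_mem hx, G.proj_of_mem hy, sub_eq_zero] using this

end GradedSpace

/-! ### Analytic tools: power series in `z, z̄` and continuation on the slice `ζ₂ = 1` -/

/-- Coefficients of order at most one of a power series in `z, z̄` are determined along a ray. -/
theorem coeff_eq_of_hasSum_ray {c : ℕ → ℕ → ℂ} {e : ℂ} {g : ℝ → ℂ} {g' : ℂ}
    (hg : HasDerivAt g g' 0)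
    (h : ∀ t : ℝ, 0 < t → t < 1 → HasSum (fun k : ℕ × ℕ =>
      c k.1 k.2 * (e * t) ^ k.1 * (starRingEnd ℂ (e * t)) ^ k.2) (g t)) :
    c 0 0 = g 0 ∧ c 1 0 * e + c 0 1 * starRingEnd ℂ e = g' := by
  -- Grouping by total degree turns the double series into a power series in the real variable `t`.
  set d : ℕ → ℂ := fun n => ∑ k ∈ Finset.HasAntidiagonal.antidiagonal n,
    c k.1 k.2 * e ^ k.1 * (starRingEnd ℂ e) ^ k.2 with hd
  have hs : ∀ t : ℝ, 0 < t → t < 1 → HasSum (fun n => t ^ n • d n) (g t) := fun t h0 h1 => by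
    have h2 := (Finset.HasAntidiagonal.sigmaAntidiagonalEquivProd.hasSum_iff).2 (h t h0 h1)
    have h3 := h2.sigma fun n => hasSum_fintype _
    convert h3 using 2 with n
    simp only [hd]
    rw [Finset.smul_sum, Finset.univ_eq_attach, ← Finset.sum_attach]
    refine Finset.sum_congr rfl fun k _ => ?_
    have hk : (k : ℕ × ℕ).1 + (k : ℕ × ℕ).2 = n := Finset.HasAntidiagonal.mem_antidiagonal.1 k.2
    simp only [Function.comp, Finset.HasAntidiagonal.sigmaAntidiagonalEquivProd_apply, map_mul,
      Complex.conj_ofReal, Complex.real_smul, Complex.ofReal_pow, mul_pow]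
    have ht : (t : ℂ) ^ n = t ^ (k : ℕ × ℕ).1 * t ^ (k : ℕ × ℕ).2 := by rw [← pow_add, hk]
    rw [ht]
    ring
  set f : ℝ → ℂ := fun t => ∑' n, t ^ n • d n with hf
  have hsum : ∀ t : ℝ, |t| < 1 → Summable (fun n => t ^ n • d n) := fun t ht => by
    by_cases h0 : t = 0
    · subst h0
      exact (hasSum_single (f := fun n => (0 : ℝ) ^ n • d n) 0 fun n hn => by
        simp [hn]).summable
    · have := (hs |t| (abs_pos.2 h0) ht).summable.norm
      refine Summable.of_norm (this.congr fun n => ?_)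
      simp
  let p : FormalMultilinearSeries ℝ ℝ ℂ := fun n => ContinuousMultilinearMap.mkPiRing ℝ (Fin n) (d n)
  have hp : ∀ n, p.coeff n = d n := fun n => by
    simp [p, FormalMultilinearSeries.coeff]
  have hfp : HasFPowerSeriesAt f p 0 := by
    rw [hasFPowerSeriesAt_iff]
    filter_upwards [Metric.ball_mem_nhds (0 : ℝ) one_pos] with t ht
    simp only [hp, zero_add]
    exact (hsum t (by simpa using ht)).hasSum
  have hder : HasDerivAt f (d 1) 0 := by
    have := hfp.hasDerivAt
    have h1 : p 1 (fun _ => 1) = d 1 := by simp [p]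
    rwa [h1] at this
  have hfg : ∀ t : ℝ, 0 < t → t < 1 → f t = g t := fun t h0 h1 => (hs t h0 h1).tsum_eq
  -- The series is known to equal `g` only for `t > 0`, so values and derivatives at `0` are
  -- compared from the right.
  have hev : f =ᶠ[nhdsWithin 0 (Set.Ioi 0)] g := by
    filter_upwards [Ioo_mem_nhdsGT (one_pos (α := ℝ))] with t ht using hfg t ht.1 ht.2
  have h00 : f 0 = g 0 := tendsto_nhds_unique
    ((hder.continuousAt.tendsto.mono_left nhdsWithin_le_nhds).congr' hev)
    (hg.continuousAt.tendsto.mono_left nhdsWithin_le_nhds)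
  have hf0 : f 0 = d 0 := by
    rw [hf]
    refine (tsum_eq_single 0 fun n hn => by simp [hn]).trans (by simp)
  have h1 : d 1 = g' := (uniqueDiffWithinAt_Ioi (0 : ℝ)).eq_deriv _ hder.hasDerivWithinAt
    (hg.hasDerivWithinAt.congr_of_eventuallyEq hev h00)
  refine ⟨?_, ?_⟩
  · rw [← h00, hf0]
    simp [hd]
  · rw [← h1, hd]
    simp [Finset.Nat.antidiagonal_succ, add_comm]

/-- Follows from `|ζ|^(2m) = (ζ ζ̄)^m`. It rewrites a series with real exponents as one fixed
monomial times a power series in `ζ, ζ̄`. -/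
theorem evalMonomial_add {ζ : ℂ} (hζ : ζ ≠ 0) (x y : ℝ) (n m : ℤ) :
    evalMonomial ζ (x + n) (y + m) = evalMonomial ζ x y * ζ ^ n * (starRingEnd ℂ ζ) ^ m := by
  have hn : (0 : ℝ) < ‖ζ‖ := norm_pos_iff.2 hζ
  have h1 : ⌊x + n - (y + m)⌋ = ⌊x - y⌋ + (n - m) := by
    rw [← Int.floor_add_intCast]
    push_cast
    congr 1
    ring
  have h2 : ((‖ζ‖ ^ (2 * (y + m)) : ℝ) : ℂ) = ((‖ζ‖ ^ (2 * y) : ℝ) : ℂ) * (ζ * starRingEnd ℂ ζ) ^ m := by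
    rw [mul_add, Real.rpow_add hn, Complex.ofReal_mul, Complex.mul_conj, Complex.normSq_eq_norm_sq,
      Real.rpow_mul hn.le 2,
      Real.rpow_mul hn.le 2, Real.rpow_intCast]
    norm_num
  rw [evalMonomial, evalMonomial, h1, h2, zpow_add₀ hζ, mul_zpow, zpow_sub₀ hζ]
  have := zpow_ne_zero m hζ
  field_simp

theorem evalMonomial_ne_zero {ζ : ℂ} (hζ : ζ ≠ 0) (x y : ℝ) : evalMonomial ζ x y ≠ 0 :=
  mul_ne_zero (zpow_ne_zero _ hζ)
    (Complex.ofReal_ne_zero.2 (Real.rpow_pos_of_pos (norm_pos_iff.2 hζ) _).ne')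

@[simp]
theorem evalMonomial_one (x y : ℝ) : evalMonomial 1 x y = 1 := by
  simp [evalMonomial]

@[simp]
theorem evalMonomial_zero_zero (ζ : ℂ) : evalMonomial ζ 0 0 = 1 := by
  simp [evalMonomial]

/-- A real analytic function on `Y₂(ℂ)` restricted to `ζ₂ = 1` is determined by its values on any
nonempty open set. -/
theorem eq_const_of_analyticOnNhd_Y2 {μ : ℂ × ℂ → ℂ} (hμ : AnalyticOnNhd ℝ μ Y2) {U : Set ℂ}
    (hU : IsOpen U) {z₀ : ℂ} (hz₀ : z₀ ∈ U) (h : (z₀, (1 : ℂ)) ∈ Y2) {k : ℂ}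
    (hk : ∀ z ∈ U, (z, (1 : ℂ)) ∈ Y2 → μ (z, 1) = k) {z : ℂ} (hz : (z, (1 : ℂ)) ∈ Y2) :
    μ (z, 1) = k := by
  have hS : {z : ℂ | (z, (1 : ℂ)) ∈ Y2} = ({0, 1} : Set ℂ)ᶜ := by
    ext z
    simp [Y2, and_comm]
  -- The slice is the plane minus two points, hence connected, as the identity theorem requires.
  have hcount : ({0, 1} : Set ℂ).Countable := Set.to_countable _
  have hconn : IsPreconnected {z : ℂ | (z, (1 : ℂ)) ∈ Y2} := by
    rw [hS]
    exact (hcount.isConnected_compl_of_one_lt_rank (by simp)).isPreconnected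
  have hopen : IsOpen {z : ℂ | (z, (1 : ℂ)) ∈ Y2} := by
    rw [hS]
    exact (Set.toFinite _).isClosed.isOpen_compl
  have han : AnalyticOnNhd ℝ (fun z : ℂ => μ (z, 1)) {z : ℂ | (z, (1 : ℂ)) ∈ Y2} := fun z hz =>
    AnalyticAt.comp₂ (hμ (z, 1) hz) analyticAt_id analyticAt_const
  refine han.eqOn_of_preconnected_of_eventuallyEq analyticOnNhd_const hconn h ?_ hz
  filter_upwards [hU.mem_nhds hz₀, hopen.mem_nhds h] with z h1 h2 using hk z h1 h2

/-- The first-order coefficients of a power series in `z, z̄` that sums to zero vanish. -/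
theorem coeff_eq_zero_of_hasSum_zero {c : ℕ → ℕ → ℂ}
    (h : ∀ ζ : ℂ, ζ ≠ 0 → ‖ζ‖ < 1 → HasSum (fun k : ℕ × ℕ =>
      c k.1 k.2 * ζ ^ k.1 * (starRingEnd ℂ ζ) ^ k.2) 0) :
    c 1 0 = 0 ∧ c 0 1 = 0 := by
  have key : ∀ e : ℂ, ‖e‖ = 1 → c 1 0 * e + c 0 1 * starRingEnd ℂ e = 0 := fun e he =>
    (coeff_eq_of_hasSum_ray (g := fun _ => 0) (hasDerivAt_const _ _) fun t h0 h1 =>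
      h (e * t) (mul_ne_zero (norm_ne_zero_iff.1 (by simp [he])) (by exact_mod_cast h0.ne'))
        (by simpa [he, abs_of_pos h0] using h1)).2
  -- Two directions suffice to separate the coefficients of `ζ` and `ζ̄`.
  have h1 := key 1 (by simp)
  have hI := key Complex.I (by simp)
  simp only [map_one, mul_one, Complex.conj_I, mul_neg] at h1 hI
  have h2 : c 1 0 - c 0 1 = 0 := by
    refine (mul_eq_zero.1 ?_).resolve_right Complex.I_ne_zero
    linear_combination hI
  constructor
  · linear_combination (h1 + h2) / 2
  · linear_combination (h1 - h2) / 2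

/-- The modulus factor is differentiated as the `y`-th power of `|1 + et|² = 1 + 2t Re e + t²|e|²`.
For integral `x - y` the result is the expected `x e + y ē`. -/
theorem hasDerivAt_evalMonomial_ray (e : ℂ) (x y : ℝ) :
    HasDerivAt (fun t : ℝ => evalMonomial (1 + e * t) x y) (⌊x - y⌋ * e + 2 * y * e.re) 0 := by
  have h1 : HasDerivAt (fun t : ℝ => (1 + e * t : ℂ)) e 0 := by
    simpa using ((Complex.ofRealCLM.hasDerivAt (x := (0 : ℝ))).const_mul e).const_add 1
  have h2 : HasDerivAt (fun t : ℝ => (1 + e * t : ℂ) ^ ⌊x - y⌋) (⌊x - y⌋ * e) 0 := by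
    have := (hasDerivAt_zpow ⌊x - y⌋ (1 + e * (0 : ℝ) : ℂ) (Or.inl (by simp))).comp (0 : ℝ) h1
    simpa [Function.comp_def] using this
  have h3 : HasDerivAt (fun t : ℝ => 1 + 2 * e.re * t + Complex.normSq e * t ^ 2) (2 * e.re) 0 := by
    have := ((((hasDerivAt_id (0 : ℝ)).const_mul (2 * e.re)).const_add 1).add
      (((hasDerivAt_id (0 : ℝ)).pow 2).const_mul (Complex.normSq e)))
    simpa [Pi.add_def] using this
  have h4 : HasDerivAt (fun t : ℝ => ‖1 + e * t‖ ^ (2 * y)) (2 * y * e.re) 0 := by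
    have := h3.rpow_const (p := y) (Or.inl (by simp))
    convert this using 1
    · funext t
      rw [Real.rpow_mul (norm_nonneg _)]
      congr 1
      rw [Real.rpow_two, ← Complex.normSq_eq_norm_sq]
      simp [Complex.normSq_apply]
      ring
    · simp
      ring
  have h5 := h2.mul h4.ofReal_comp
  have e1 : ⌊x - y⌋ * e * ↑(‖1 + e * (0 : ℝ)‖ ^ (2 * y)) + (1 + e * (0 : ℝ)) ^ ⌊x - y⌋ *
      ((2 * y * e.re : ℝ) : ℂ) = ⌊x - y⌋ * e + 2 * y * e.re := by simp
  rw [e1] at h5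
  exact h5

/-! ### Consequences of locality -/

namespace FullVertexAlgebra

variable {F : Type*} [AddCommGroup F] [Module ℂ F] (V : FullVertexAlgebra F)

theorem mode_mem {p q : ℝ × ℝ} {a v : F} (ha : a ∈ V.gr p) (hv : v ∈ V.gr q) (r s : ℝ) :
    V.mode a r s v ∈ V.gr (p.1 + q.1 - r - 1, p.2 + q.2 - s - 1) := by
  rw [GradedSpace.mem_gr_iff] at ha hv ⊢
  constructor
  · have h := LinearMap.congr_fun (V.L0_cov a r s) v
    simp only [LinearMap.sub_apply, Module.End.mul_apply, hv.1, ha.1, map_smul, LinearMap.add_apply,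
      LinearMap.smul_apply, Pi.smul_apply] at h
    rw [sub_eq_iff_eq_add.1 h]
    push_cast
    module
  · have h := LinearMap.congr_fun (V.Lbar0_cov a r s) v
    simp only [LinearMap.sub_apply, Module.End.mul_apply, hv.2, ha.2, map_smul, LinearMap.add_apply,
      LinearMap.smul_apply, Pi.smul_apply] at h
    rw [sub_eq_iff_eq_add.1 h]
    push_cast
    module

theorem weight_nonneg_of_ne_zero {p : ℝ × ℝ} {v : F} (hv : v ∈ V.gr p) (h : v ≠ 0) :
    0 ≤ p.1 ∧ 0 ≤ p.2 := by
  by_contra hp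
  rw [V.weight_nonneg p hp] at hv
  exact h hv

theorem exists_nat_of_mode_vac_ne_zero {a : F} {r s : ℝ} (h : V.mode a r s V.vac ≠ 0) :
    ∃ n m : ℕ, -r - 1 = (n : ℝ) ∧ -s - 1 = (m : ℝ) := by
  by_contra h'
  exact h (V.creation a r s h')

theorem eq_of_mode_vac_ne_zero {a : F} {r s : ℝ} (h : V.mode V.vac r s a ≠ 0) :
    r = -1 ∧ s = -1 := by
  by_contra h'
  refine h ?_
  rw [V.vac_mode r s fun h => h' (Prod.mk.inj h), LinearMap.zero_apply]

/-- This weight count is what reduces the locality series to power series or to single terms. -/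
theorem dual_mode_eq_zero_or {p₀ p q : ℝ × ℝ} {u : Module.Dual ℂ F}
    (hu : ∀ q, q ≠ p₀ → ∀ v ∈ V.gr q, u v = 0) {a v : F} (ha : a ∈ V.gr p) (hv : v ∈ V.gr q)
    {r s : ℝ} (h : u (V.mode a r s v) ≠ 0) :
    p.1 + q.1 - r - 1 = p₀.1 ∧ p.2 + q.2 - s - 1 = p₀.2 := by
  by_contra h'
  exact h (hu _ (fun e => h' (by rw [← e]; exact ⟨rfl, rfl⟩)) _ (V.mode_mem ha hv r s))

/-- If `u` has weight `(0, 0)` and `a(h-1,h'-1)u = 0`, then the modes of `a ∈ F_{h,h'}` that lower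
the weight by one annihilate the derivatives of `u`. -/
theorem mode_mode_vac_eq_zero {h h' : ℝ} {a u : F} (ha : a ∈ V.gr (h, h')) (hu : u ∈ V.gr (0, 0))
    (hau : V.mode a (h - 1) (h' - 1) u = 0) :
    V.mode a h (h' - 1) (V.mode u (-2) (-1) V.vac) = 0 ∧
      V.mode a (h - 1) h' (V.mode u (-1) (-2) V.vac) = 0 := by
  have key : ∀ w : Module.Dual ℂ F, (∀ q, q ≠ ((0 : ℝ), (0 : ℝ)) → ∀ v ∈ V.gr q, w v = 0) →
      w (V.mode a h (h' - 1) (V.mode u (-2) (-1) V.vac)) = 0 ∧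
      w (V.mode a (h - 1) h' (V.mode u (-1) (-2) V.vac)) = 0 := by
    intro w hw
    obtain ⟨μ, hμ, hprod, hiter, -⟩ :=
      V.locality (0, 0) (h, h') (0, 0) (0, 0) w a u V.vac hw ha hu V.vac_mem
    -- Modes acting on the vacuum only raise weights, and `w` sees only weight `(0,0)`. So `a(r,s)u`
    -- must itself have weight `(0,0)`, which is the case excluded by `hau`.
    have hterm : ∀ r s r' s', w (V.mode (V.mode a r s u) r' s' V.vac) = 0 := by
      intro r s r' s'
      by_contra hne
      have hx := V.mode_mem ha hu r s
      have hne' : V.mode (V.mode a r s u) r' s' V.vac ≠ 0 := fun e => hne (by rw [e, map_zero])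
      have hxne : V.mode a r s u ≠ 0 := fun e => hne (by simp [e])
      obtain ⟨h1, h2⟩ := V.weight_nonneg_of_ne_zero hx hxne
      obtain ⟨h3, h4⟩ := V.dual_mode_eq_zero_or hw hx V.vac_mem hne
      obtain ⟨n, m, h5, h6⟩ := V.exists_nat_of_mode_vac_ne_zero hne'
      have hn : (0 : ℝ) ≤ n := n.cast_nonneg
      have hm : (0 : ℝ) ≤ m := m.cast_nonneg
      simp only at h1 h2 h3 h4
      obtain rfl : r = h - 1 := by linarith
      obtain rfl : s = h' - 1 := by linarith
      exact hxne hau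
    have hzero : ∀ z : ℂ, (z, (1 : ℂ)) ∈ Y2 → μ (z, 1) = 0 := fun z hz => by
      refine eq_const_of_analyticOnNhd_Y2 hμ (Metric.isOpen_ball (x := (1 : ℂ)) (ε := 1))
        (z₀ := 1 / 2) (by norm_num [Complex.dist_eq]) (by norm_num [Y2]) (fun z h1 h2 => ?_) hz
      have := hiter (z - 1) 1 (by simpa using h2) (by simpa [Complex.dist_eq] using h1)
      rw [sub_add_cancel] at this
      refine this.unique (hasSum_zero.congr_fun fun x => ?_)
      rw [seriesTerm, hterm, zero_mul, zero_mul]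
    -- At `ζ₁ = ζ⁻¹`, `ζ₂ = 1` the product series is a monomial times a power series in `ζ, ζ̄` with
    -- these coefficients; those of order one are the two quantities sought.
    let c : ℕ → ℕ → ℂ := fun n m =>
      w (V.mode a (h - 1 + n) (h' - 1 + m) (V.mode u (-1 - n) (-1 - m) V.vac))
    have hc : c 1 0 = 0 ∧ c 0 1 = 0 := by
      refine coeff_eq_zero_of_hasSum_zero fun ζ h0 h1 => ?_
      have hlt : 1 < ‖ζ⁻¹‖ := by
        rw [norm_inv]
        exact (one_lt_inv₀ (norm_pos_iff.2 h0)).2 h1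
      have hY : (ζ⁻¹, (1 : ℂ)) ∈ Y2 :=
        ⟨fun e => by simp only at e; rw [e] at hlt; simp at hlt, inv_ne_zero h0, one_ne_zero⟩
      have hs := hprod ζ⁻¹ 1 hY (by simpa using hlt)
      rw [hzero _ hY] at hs
      let ι : ℕ × ℕ → (ℝ × ℝ) × (ℝ × ℝ) := fun k =>
        ((h - 1 + k.1, h' - 1 + k.2), (-1 - k.1, -1 - k.2))
      have hι : Function.Injective ι := fun k l e => by
        simp only [ι, Prod.mk.injEq, add_right_inj, Nat.cast_inj] at e
        exact Prod.ext e.1.1 e.1.2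
      rw [← hι.hasSum_iff] at hs
      · have h2 := hs.mul_left (evalMonomial ζ⁻¹ (-h) (-h'))⁻¹
        rw [mul_zero] at h2
        refine h2.congr_fun fun k => ?_
        have e1 : -(h - 1 + (k.1 : ℝ)) - 1 = -h + ((-k.1 : ℤ) : ℝ) := by push_cast; ring
        have e2 : -(h' - 1 + (k.2 : ℝ)) - 1 = -h' + ((-k.2 : ℤ) : ℝ) := by push_cast; ring
        have := evalMonomial_ne_zero (inv_ne_zero h0) (-h) (-h')
        simp only [seriesTerm, Function.comp, ι, e1, e2, evalMonomial_add (inv_ne_zero h0),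
          evalMonomial_one, c, map_inv₀, inv_zpow', neg_neg, zpow_natCast]
        generalize evalMonomial ζ⁻¹ (-h) (-h') = k at this ⊢
        field_simp
      · rintro ⟨⟨r, s⟩, r', s'⟩ hx
        simp only [seriesTerm]
        by_cases hne : w (V.mode a r s (V.mode u r' s' V.vac)) = 0
        · rw [hne, zero_mul, zero_mul]
        · refine absurd ?_ hx
          have hne' : V.mode u r' s' V.vac ≠ 0 := fun e => hne (by simp [e])
          obtain ⟨h3, h4⟩ := V.dual_mode_eq_zero_or hw ha (V.mode_mem hu V.vac_mem r' s') hne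
          obtain ⟨n, m, h5, h6⟩ := V.exists_nat_of_mode_vac_ne_zero hne'
          simp only at h3 h4
          refine ⟨(n, m), ?_⟩
          simp only [ι, Prod.mk.injEq]
          refine ⟨⟨?_, ?_⟩, ?_, ?_⟩ <;> linarith
    have e : (-1 : ℝ) - 1 = -2 := by norm_num
    simpa [c, e] using hc
  have m1 := V.mode_mem ha (V.mode_mem hu V.vac_mem (-2) (-1)) h (h' - 1)
  have m2 := V.mode_mem ha (V.mode_mem hu V.vac_mem (-1) (-2)) (h - 1) h'
  simp only at m1 m2
  rw [show (h + (0 + 0 - -2 - 1) - h - 1, h' + (0 + 0 - -1 - 1) - (h' - 1) - 1) = ((0 : ℝ), (0 : ℝ))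
    from Prod.ext (by ring) (by ring)] at m1
  rw [show (h + (0 + 0 - -1 - 1) - (h - 1) - 1, h' + (0 + 0 - -2 - 1) - h' - 1) = ((0 : ℝ), (0 : ℝ))
    from Prod.ext (by ring) (by ring)] at m2
  constructor
  · exact V.eq_of_forall_dual m1 (zero_mem _) fun w hw => by rw [(key w hw).1, map_zero]
  · exact V.eq_of_forall_dual m2 (zero_mem _) fun w hw => by rw [(key w hw).2, map_zero]

end FullVertexAlgebra

theorem hasSum_of_forall_ne {ι : Type*} {f : ι → ℂ} {x : ℂ} (i : ι) (hi : f i = x)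
    (h : ∀ j, j ≠ i → f j = 0) : HasSum f x :=
  hi ▸ hasSum_single i h

namespace FullVertexAlgebra

variable {F : Type*} [AddCommGroup F] [Module ℂ F] (V : FullVertexAlgebra F)

/-- If both derivatives of `v` vanish, then `Y(v, z, z̄)` is constant. -/
theorem mode_eq_zero_of_derivative_eq_zero {v : F} (hv : v ∈ V.gr (0, 0))
    (hD : V.mode v (-2) (-1) V.vac = 0) (hDbar : V.mode v (-1) (-2) V.vac = 0) {r s : ℝ}
    (hrs : ¬ (r = -1 ∧ s = -1)) : V.mode v r s = 0 := by
  refine V.hom_ext fun q x hx => ?_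
  rw [LinearMap.zero_apply]
  have hmem := V.mode_mem hv hx r s
  refine V.eq_of_forall_dual hmem (zero_mem _) fun w hw => ?_
  rw [map_zero]
  obtain ⟨μ, -, hprod, hiter, -⟩ := V.locality _ (0, 0) (0, 0) q w v V.vac x hw hv V.vac_mem hx
  set K : ℂ := w (V.mode v r s x) with hK
  -- Since `b = 𝟏` and `w` fixes the target weight, the product series has a single possibly nonzero
  -- term.
  have hμ1 : ∀ z : ℂ, 1 < ‖z‖ → μ (z, 1) = K * evalMonomial z (-r - 1) (-s - 1) := fun z hz => by
    have hY : (z, (1 : ℂ)) ∈ Y2 :=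
      ⟨fun e => by simp only at e; rw [e] at hz; simp at hz, norm_pos_iff.1 (one_pos.trans hz),
        one_ne_zero⟩
    refine (hprod z 1 hY (by simpa using hz)).unique ?_
    refine hasSum_of_forall_ne ((r, s), (-1, -1)) ?_ ?_
    · simp [seriesTerm, V.vac_const, hK]
    · rintro ⟨⟨r', s'⟩, r'', s''⟩ hne
      simp only [seriesTerm]
      by_cases h0 : w (V.mode v r' s' (V.mode V.vac r'' s'' x)) = 0
      · rw [h0, zero_mul, zero_mul]
      · refine absurd ?_ hne
        obtain ⟨rfl, rfl⟩ := V.eq_of_mode_vac_ne_zero (a := x) (r := r'') (s := s'')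
          fun e => h0 (by simp [e])
        rw [V.vac_const, Module.End.one_apply] at h0
        obtain ⟨h3, h4⟩ := V.dual_mode_eq_zero_or hw hv hx h0
        simp only at h3 h4
        simp only [Prod.mk.injEq, and_true]
        constructor <;> linarith
  let c : ℕ → ℕ → ℂ := fun n m =>
    w (V.mode (V.mode v (-1 - n) (-1 - m) V.vac) (r + n) (s + m) x)
  have hser : ∀ ζ : ℂ, ζ ≠ 0 → ‖ζ‖ < 1 → HasSum (fun k : ℕ × ℕ =>
      c k.1 k.2 * ζ ^ k.1 * (starRingEnd ℂ ζ) ^ k.2) (μ (ζ + 1, 1)) := fun ζ h0 h1 => by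
    have hne : ζ + 1 ≠ 0 := fun e => by
      rw [eq_neg_of_add_eq_zero_left e] at h1
      simp at h1
    have hs := hiter ζ 1 ⟨by simpa using h0, hne, one_ne_zero⟩ (by simpa using h1)
    let ι : ℕ × ℕ → (ℝ × ℝ) × (ℝ × ℝ) := fun k =>
      ((-1 - k.1, -1 - k.2), (r + k.1, s + k.2))
    have hι : Function.Injective ι := fun k l e => by
      simp only [ι, Prod.mk.injEq, add_right_inj, Nat.cast_inj] at e
      exact Prod.ext e.2.1 e.2.2
    rw [← hι.hasSum_iff] at hs
    · refine hs.congr_fun fun k => ?_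
      have e1 : -(-1 - (k.1 : ℝ)) - 1 = 0 + ((k.1 : ℤ) : ℝ) := by push_cast; ring
      have e2 : -(-1 - (k.2 : ℝ)) - 1 = 0 + ((k.2 : ℤ) : ℝ) := by push_cast; ring
      simp only [seriesTerm, Function.comp, ι, e1, e2, evalMonomial_add h0,
        evalMonomial_one, evalMonomial_zero_zero, c, zpow_natCast, one_mul, mul_one, mul_assoc]
    · rintro ⟨⟨r', s'⟩, r'', s''⟩ hx'
      simp only [seriesTerm]
      by_cases h0 : w (V.mode (V.mode v r' s' V.vac) r'' s'' x) = 0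
      · rw [h0, zero_mul, zero_mul]
      · refine absurd ?_ hx'
        have hne' : V.mode v r' s' V.vac ≠ 0 := fun e => h0 (by simp [e])
        obtain ⟨h3, h4⟩ := V.dual_mode_eq_zero_or hw (V.mode_mem hv V.vac_mem r' s') hx h0
        obtain ⟨n, m, h5, h6⟩ := V.exists_nat_of_mode_vac_ne_zero hne'
        simp only at h3 h4
        refine ⟨(n, m), ?_⟩
        simp only [ι, Prod.mk.injEq]
        refine ⟨⟨?_, ?_⟩, ?_, ?_⟩ <;> linarith
  have e0 : (-1 : ℝ) - 1 = -2 := by norm_num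
  have hc10 : c 1 0 = 0 := by simp [c, e0, hD]
  have hc01 : c 0 1 = 0 := by simp [c, e0, hDbar]
  -- The condition `0 ≤ e.re` keeps `1 + et` outside the unit disc, where the monomial formula and
  -- the iterate series are both available. The latter has no first-order part because `Dv = D̄v =
  -- 0`.
  have key : ∀ e : ℂ, ‖e‖ = 1 → 0 ≤ e.re →
      K * (⌊-r - 1 - (-s - 1)⌋ * e + 2 * (-s - 1 : ℝ) * e.re) = 0 := fun e he hre => by
    have := (coeff_eq_of_hasSum_ray (c := c) (e := e)
      ((hasDerivAt_evalMonomial_ray e (-r - 1) (-s - 1)).const_mul K) fun t h0 h1 => ?_).2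
    · rw [← this, hc10, hc01, zero_mul, zero_mul, add_zero]
    · have hnorm : 1 < ‖1 + e * (t : ℂ)‖ := by
        have h2 : 1 < ‖1 + e * (t : ℂ)‖ ^ 2 := by
          have h3 : Complex.normSq e = 1 := by rw [Complex.normSq_eq_norm_sq, he, one_pow]
          rw [Complex.normSq_apply] at h3
          rw [← Complex.normSq_eq_norm_sq, Complex.normSq_apply]
          simp only [Complex.add_re, Complex.one_re, Complex.mul_re, Complex.ofReal_re,
            Complex.ofReal_im, mul_zero, sub_zero, Complex.add_im, Complex.one_im, Complex.mul_im,
            zero_add]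
          nlinarith [mul_nonneg hre h0.le, mul_pos h0 h0]
        exact (one_lt_sq_iff₀ (norm_nonneg _)).1 h2
      have := hser (e * t) (mul_ne_zero (norm_ne_zero_iff.1 (by simp [he]))
        (by exact_mod_cast h0.ne')) (by simpa [he, abs_of_pos h0] using h1)
      rwa [add_comm, hμ1 _ hnorm] at this
  by_contra hne
  have h1 := (mul_eq_zero.1 (key 1 (by simp) (by simp))).resolve_left hne
  have hI := (mul_eq_zero.1 (key Complex.I (by simp) (by simp))).resolve_left hne
  simp only [Complex.I_re, Complex.ofReal_zero, mul_zero, add_zero, mul_eq_zero, Complex.I_ne_zero,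
    or_false] at hI
  rw [hI] at h1
  have hs : s = -1 := by
    have : (-s - 1 : ℝ) = 0 := by
      rw [zero_mul, zero_add, Complex.one_re, Complex.ofReal_one, mul_one,
        mul_eq_zero] at h1
      exact_mod_cast h1.resolve_left two_ne_zero
    linarith
  -- Integrality is needed because `hI` only controls the floor of the exponent difference.
  obtain ⟨n, hn⟩ : ∃ n : ℤ, r - s = n := by
    by_contra h
    exact hne (by rw [hK, V.mode_int v r s h, LinearMap.zero_apply, map_zero])
  have hfl : -r - 1 - (-s - 1) = ((-n : ℤ) : ℝ) := by
    push_cast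
    linarith
  rw [hfl, Int.floor_intCast] at hI
  have hn0 : n = 0 := by simpa using hI
  rw [hn0] at hn
  exact hrs ⟨by push_cast at hn; linarith, hs⟩

/-- If `Y(v, z, z̄)` is constant, then it commutes with all vertex operators. -/
theorem commute_mode_of_forall_eq_zero {v : F} (hv : v ∈ V.gr (0, 0))
    (h : ∀ r s : ℝ, ¬ (r = -1 ∧ s = -1) → V.mode v r s = 0) (b x : F) (r s : ℝ) :
    V.mode v (-1) (-1) (V.mode b r s x) = V.mode b r s (V.mode v (-1) (-1) x) := by
  let M : F →ₗ[ℂ] Module.End ℂ F := LinearMap.proj s ∘ₗ LinearMap.proj r ∘ₗ V.mode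
  suffices H : LinearMap.mulLeft ℂ (V.mode v (-1) (-1)) ∘ₗ M =
      LinearMap.mulRight ℂ (V.mode v (-1) (-1)) ∘ₗ M from
    LinearMap.congr_fun (LinearMap.congr_fun H b) x
  refine V.hom_ext fun p b hb => V.hom_ext fun q x hx => ?_
  change V.mode v (-1) (-1) (V.mode b r s x) = V.mode b r s (V.mode v (-1) (-1) x)
  have m1 := V.mode_mem hb hx r s
  have m2 := V.mode_mem hb (V.mode_mem hv hx (-1) (-1)) r s
  have m3 := V.mode_mem hv m1 (-1) (-1)
  simp only [zero_add, sub_neg_eq_add, sub_add_cancel, add_sub_cancel_right] at m1 m2 m3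
  refine V.eq_of_forall_dual m3 m2 fun w hw => ?_
  obtain ⟨μ, hμ, hprod, -, hop⟩ := V.locality _ (0, 0) p q w v b x hw hv hb hx
  have hconst : ∀ z : ℂ, (z, (1 : ℂ)) ∈ Y2 → μ (z, 1) = w (V.mode v (-1) (-1) (V.mode b r s x)) := by
    intro z hz
    refine eq_const_of_analyticOnNhd_Y2 hμ (U := {z | 1 < ‖z‖}) (z₀ := 2)
      (isOpen_lt continuous_const continuous_norm) (by simp) (by simp [Y2]) (fun z h1 h2 => ?_) hz
    refine (hprod z 1 h2 (by simpa using h1)).unique ?_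
    refine hasSum_of_forall_ne ((-1, -1), (r, s)) ?_ ?_
    · simp [seriesTerm]
    · rintro ⟨⟨r', s'⟩, r'', s''⟩ hne
      simp only [seriesTerm]
      by_cases h0 : w (V.mode v r' s' (V.mode b r'' s'' x)) = 0
      · rw [h0, zero_mul, zero_mul]
      · refine absurd ?_ hne
        obtain ⟨rfl, rfl⟩ : r' = -1 ∧ s' = -1 := by
          by_contra h'
          exact h0 (by rw [h r' s' h', LinearMap.zero_apply, map_zero])
        obtain ⟨h3, h4⟩ := V.dual_mode_eq_zero_or hw hv (V.mode_mem hb hx r'' s'') h0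
        simp only at h3 h4
        simp only [Prod.mk.injEq, true_and]
        constructor <;> linarith
  -- A point with `|ζ₁| < |ζ₂|`, where the opposite product also reduces to one term.
  have hY : ((1 / 2 : ℂ), (1 : ℂ)) ∈ Y2 := by norm_num [Y2]
  refine (hconst _ hY).symm.trans ((hop _ 1 hY (by norm_num)).unique ?_)
  refine hasSum_of_forall_ne ((r, s), (-1, -1)) ?_ ?_
  · simp [seriesTerm]
  · rintro ⟨⟨r'', s''⟩, r', s'⟩ hne
    simp only [seriesTerm]
    by_cases h0 : w (V.mode b r'' s'' (V.mode v r' s' x)) = 0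
    · rw [h0, zero_mul, zero_mul]
    · refine absurd ?_ hne
      obtain ⟨rfl, rfl⟩ : r' = -1 ∧ s' = -1 := by
        by_contra h'
        exact h0 (by rw [h r' s' h', LinearMap.zero_apply, map_zero, map_zero])
      obtain ⟨h3, h4⟩ := V.dual_mode_eq_zero_or hw hb (V.mode_mem hv hx (-1) (-1)) h0
      simp only at h3 h4
      simp only [Prod.mk.injEq, and_true]
      constructor <;> linarith

end FullVertexAlgebra

/-! ### Invariant forms, unitarity and the two implications -/

namespace FullVOA

variable {F : Type*} [AddCommGroup F] [Module ℂ F] {V : FullVOA F}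

theorem mode_ν_one (V : FullVOA F) : V.mode V.ν 1 (-1) = V.L0 :=
  V.hom_ext fun p v hv => by rw [V.ν_one p v hv]; exact ((V.mem_gr_iff.1 hv).1).symm

theorem mode_νbar_one (V : FullVOA F) : V.mode V.νbar (-1) 1 = V.Lbar0 :=
  V.hom_ext fun p v hv => by rw [V.νbar_one p v hv]; exact ((V.mem_gr_iff.1 hv).2).symm

theorem L_one (V : FullVOA F) : V.L 1 = V.mode V.ν 2 (-1) := by
  rw [L]
  norm_num

theorem Lbar_one (V : FullVOA F) : V.Lbar 1 = V.mode V.νbar (-1) 2 := by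
  rw [Lbar]
  norm_num

/-- Invariance for a quasi-primary vector `a`. -/
theorem IsInvariant.apply_mode {B : LinearMap.BilinForm ℂ F} (hB : V.IsInvariant B) {h h' : ℝ}
    {a : F} (ha : a ∈ V.gr (h, h')) (hL : V.L 1 a = 0) (hLbar : V.Lbar 1 a = 0) (r s : ℝ)
    (u v : F) :
    B u (V.mode a r s v) =
      (-1 : ℂ) ^ ⌊h - h'⌋ * B (V.mode a (2 * h - r - 2) (2 * h' - s - 2) u) v := by
  rw [hB h h' a ha r s u v, finsum_eq_single _ (0, 0)]
  · simp
  · rintro ⟨n, m⟩ hnm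
    have : (V.L 1 ^ n) ((V.Lbar 1 ^ m) a) = 0 := by
      rcases m with _ | m
      · rcases n with _ | n
        · exact absurd rfl hnm
        · rw [pow_zero, Module.End.one_apply, pow_succ, Module.End.mul_apply, hL, map_zero]
      · rw [pow_succ, Module.End.mul_apply, hLbar, map_zero, map_zero]
    simp [this]

theorem L_one_ν (V : FullVOA F) : V.L 1 V.ν = 0 := by
  simpa [L_one] using V.ν_ν 2 (Or.inl rfl)

theorem Lbar_one_νbar (V : FullVOA F) : V.Lbar 1 V.νbar = 0 := by
  simpa [Lbar_one] using V.νbar_νbar 2 (Or.inl rfl)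

/-- The vector would have weight `(2,-1)`. -/
theorem Lbar_one_ν (V : FullVOA F) : V.Lbar 1 V.ν = 0 := by
  rw [Lbar_one]
  by_contra h
  have := V.weight_nonneg_of_ne_zero (V.mode_mem V.νbar_mem V.ν_mem (-1) 2) h
  norm_num at this

theorem L_one_νbar (V : FullVOA F) : V.L 1 V.νbar = 0 := by
  rw [L_one]
  by_contra h
  have := V.weight_nonneg_of_ne_zero (V.mode_mem V.ν_mem V.νbar_mem 2 (-1)) h
  norm_num at this

/-- `φ` fixes `ν` and `ν̄`, hence commutes with `L(0)` and `L̄(0)`, whose eigenvalues are real and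
so unaffected by anti-linearity. -/
theorem IsAntilinearInvolution.map_mem {φ : F →ₛₗ[starRingEnd ℂ] F}
    (hφ : V.IsAntilinearInvolution φ) {p : ℝ × ℝ} {v : F} (hv : v ∈ V.gr p) : φ v ∈ V.gr p := by
  rw [V.mem_gr_iff] at hv ⊢
  constructor
  · rw [← V.mode_ν_one, ← hφ.map_ν, ← hφ.map_mode, V.mode_ν_one, hv.1, map_smulₛₗ, Complex.conj_ofReal]
  · rw [← V.mode_νbar_one, ← hφ.map_νbar, ← hφ.map_mode, V.mode_νbar_one, hv.2, map_smulₛₗ, Complex.conj_ofReal]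

/-- A nonzero ideal contains a nonzero homogeneous vector killed by `L(1)` and `L̄(1)`. -/
theorem IsIdeal.exists_quasiprimary {I : Submodule ℂ F} (hI : V.IsIdeal I)
    (hne : I ≠ ⊥) : ∃ p, ∃ x ∈ V.gr p, x ∈ I ∧ x ≠ 0 ∧ V.L 1 x = 0 ∧ V.Lbar 1 x = 0 := by
  obtain ⟨v, hv, hv0⟩ := I.exists_mem_ne_zero_of_ne_bot hne
  obtain ⟨p, x, hxp, hxI, hx0⟩ := V.exists_homogeneous_mem
    (fun v hv => V.mode_ν_one ▸ hI _ v hv _ _) (fun v hv => V.mode_νbar_one ▸ hI _ v hv _ _) hv hv0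
  -- `L(1)` and `L̄(1)` each lower the total weight by one, and it cannot become negative.
  obtain ⟨n, hn⟩ := exists_nat_gt (p.1 + p.2)
  induction n generalizing p x with
  | zero =>
    have := V.weight_nonneg_of_ne_zero hxp hx0
    norm_num at hn
    linarith
  | succ n ih =>
    push_cast at hn
    by_cases h1 : V.L 1 x = 0
    · by_cases h2 : V.Lbar 1 x = 0
      · exact ⟨p, x, hxp, hxI, hx0, h1, h2⟩
      · rw [Lbar_one] at h2
        refine ih _ _ (V.mode_mem V.νbar_mem hxp (-1) 2) (hI _ _ hxI _ _) h2 ?_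
        simp only
        linarith
    · rw [L_one] at h1
      refine ih _ _ (V.mode_mem V.ν_mem hxp 2 (-1)) (hI _ _ hxI _ _) h1 ?_
      simp only
      linarith

namespace IsUnitary

variable {φ : F →ₛₗ[starRingEnd ℂ] F} {B : LinearMap.BilinForm ℂ F}

theorem eq_zero_of_apply_eq_zero (hU : V.IsUnitary φ B) {v : F} (h : B (φ v) v = 0) : v = 0 := by
  by_contra hv
  have := (hU.pos_def v hv).1
  simp [h] at this

theorem vac_ne_zero (hU : V.IsUnitary φ B) : V.vac ≠ 0 := fun h => by
  have := hU.normalized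
  simp [h] at this

/-- In a unitary full VOA, vectors of weight `(0, 0)` are translation invariant. -/
theorem mode_vac_eq_zero (hU : V.IsUnitary φ B) {v : F} (hv : v ∈ V.gr (0, 0)) :
    V.mode v (-2) (-1) V.vac = 0 ∧ V.mode v (-1) (-2) V.vac = 0 := by
  have hφv := hU.involution.map_mem hv
  constructor
  -- `ν` is quasi-primary of weight `(2,0)`, so moving `ν(0,-1)` across the form gives `ν(2,-1) =
  -- L(1)`, applied to `D φ(v)`.
  · refine hU.eq_zero_of_apply_eq_zero ?_
    rw [hU.involution.map_mode, hU.involution.map_vac, ← V.ν_zero v,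
      hU.invariant.apply_mode V.ν_mem V.L_one_ν V.Lbar_one_ν]
    have := (V.mode_mode_vac_eq_zero V.ν_mem hφv (by
      have := V.ν_one _ _ hφv
      norm_num at this ⊢
      exact this)).1
    norm_num at this ⊢
    simp [this]
  · refine hU.eq_zero_of_apply_eq_zero ?_
    rw [hU.involution.map_mode, hU.involution.map_vac, ← V.νbar_zero v,
      hU.invariant.apply_mode V.νbar_mem V.L_one_νbar V.Lbar_one_νbar]
    have := (V.mode_mode_vac_eq_zero V.νbar_mem hφv (by
      have := V.νbar_one _ _ hφv
      norm_num at this ⊢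
      exact this)).2
    norm_num at this ⊢
    simp [this]

theorem gr_zero_eq_span_of_isSimple (hU : V.IsUnitary φ B) (hS : V.IsSimple) :
    V.gr (0, 0) = Submodule.span ℂ {V.vac} := by
  refine le_antisymm (fun v hv => ?_)
    ((Submodule.span_singleton_le_iff_mem _ _).2 V.vac_mem)
  obtain ⟨h1, h2⟩ := hU.mode_vac_eq_zero hv
  have hcomm := V.commute_mode_of_forall_eq_zero hv fun r s =>
    V.mode_eq_zero_of_derivative_eq_zero hv h1 h2
  have hmaps : ∀ x ∈ V.gr (0, 0), V.mode v (-1) (-1) x ∈ V.gr (0, 0) := fun x hx => by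
    simpa using V.mode_mem hv hx (-1) (-1)
  have : FiniteDimensional ℂ (V.gr (0, 0)) := by
    have := V.finite_dim 0
    exact Submodule.finiteDimensional_of_le (le_iSup₂_of_le (f := fun p (_ : p.1 + p.2 ≤ (0 : ℝ)) =>
      V.gr p) (0, 0) (by simp) le_rfl)
  have : Nontrivial (V.gr (0, 0)) :=
    ⟨⟨V.vac, V.vac_mem⟩, 0, fun h => hU.vac_ne_zero (congrArg Subtype.val h)⟩
  obtain ⟨c, hc⟩ := Module.End.exists_eigenvalue ((V.mode v (-1) (-1)).restrict hmaps)
  obtain ⟨x, hx⟩ := hc.exists_hasEigenvector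
  have hxc : V.mode v (-1) (-1) x = c • (x : F) := congrArg Subtype.val hx.apply_eq_smul
  have hxne : (x : F) ≠ 0 := fun h => hx.2 (Subtype.ext h)
  -- The eigenspace is taken in all of `F`; finite-dimensionality of `F_{0,0}` served only to make
  -- it nonzero.
  have hI : V.IsIdeal (Module.End.eigenspace (V.mode v (-1) (-1)) c) := fun a y hy r s => by
    rw [Module.End.mem_eigenspace_iff] at hy ⊢
    rw [hcomm, hy, map_smul]
  rcases hS _ hI with h | h
  · exact absurd ((Submodule.eq_bot_iff _).1 h x (Module.End.mem_eigenspace_iff.2 hxc)) hxne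
  · have : V.vac ∈ Module.End.eigenspace (V.mode v (-1) (-1)) c := h ▸ Submodule.mem_top
    rw [Module.End.mem_eigenspace_iff, V.creation_const] at this
    exact Submodule.mem_span_singleton.2 ⟨c, this.symm⟩

theorem isSimple_of_gr_zero_eq_span (hU : V.IsUnitary φ B)
    (h : V.gr (0, 0) = Submodule.span ℂ {V.vac}) : V.IsSimple := by
  intro I hI
  rw [or_iff_not_imp_left]
  intro hne
  obtain ⟨⟨d, d'⟩, x, hxp, hxI, hx0, h1, h2⟩ := hI.exists_quasiprimary hne
  have e1 : V.L 1 (φ x) = 0 := by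
    rw [L_one, ← hU.involution.map_ν, ← hU.involution.map_mode, ← L_one, h1, map_zero]
  have e2 : V.Lbar 1 (φ x) = 0 := by
    rw [Lbar_one, ← hU.involution.map_νbar, ← hU.involution.map_mode, ← Lbar_one, h2, map_zero]
  have hφx := hU.involution.map_mem hxp
  -- These indices send `x` to weight `(0,0)`; their adjoint indices are `(-1,-1)`, so pairing with
  -- `𝟏` gives `±(φ(x), x)`.
  have hmem := V.mode_mem hφx hxp (2 * d - 1) (2 * d' - 1)
  rw [show ((d, d').1 + (d, d').1 - (2 * d - 1) - 1, (d, d').2 + (d, d').2 - (2 * d' - 1) - 1)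
    = ((0 : ℝ), (0 : ℝ)) from Prod.ext (by ring) (by ring), h] at hmem
  obtain ⟨c, hc⟩ := Submodule.mem_span_singleton.1 hmem
  have hB := hU.invariant.apply_mode hφx e1 e2 (2 * d - 1) (2 * d' - 1) V.vac x
  rw [show 2 * d - (2 * d - 1) - 2 = -1 by ring, show 2 * d' - (2 * d' - 1) - 2 = -1 by ring,
    V.creation_const, ← hc, map_smul, hU.normalized, smul_eq_mul, mul_one] at hB
  have hc0 : c ≠ 0 := by
    rw [hB]
    exact mul_ne_zero (zpow_ne_zero _ (by norm_num)) fun h => hx0 (hU.eq_zero_of_apply_eq_zero h)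
  have hvac : V.vac ∈ I := by
    rw [← I.smul_mem_iff hc0, hc]
    exact hI _ _ hxI _ _
  refine (Submodule.eq_top_iff').2 fun a => ?_
  rw [← V.creation_const a]
  exact hI _ _ hvac _ _

end IsUnitary

end FullVOA

end FullVA

theorem mainTheorem4 {F : Type*} [AddCommGroup F] [Module ℂ F] (V : FullVA.FullVOA F)
    (φ : F →ₛₗ[starRingEnd ℂ] F) (B : LinearMap.BilinForm ℂ F) (hU : V.IsUnitary φ B) :
    V.IsSimple ↔ V.gr (0, 0) = Submodule.span ℂ {V.vac} :=
  ⟨hU.gr_zero_eq_span_of_isSimple, hU.isSimple_of_gr_zero_eq_span⟩
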